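/- All graphs are finite, undirected and loopless; $\alpha(G)$ denotes the independence number of $G$. Let $G^n$ be the graph whose vertices are the $n$-tuples of vertices of $G$, two distinct tuples $(u_1,\dots,u_n)$ and $(v_1,\dots,v_n)$ being adjacent if and only if for every $i$ either $u_i=v_i$ or $u_iv_i$ is an edge of $G$. The Shannon capacity of $G$ is $c(G)=\lim_{n\to\infty}\alpha(G^n)^{1/n}$. Theorem 3. Suppose that the supremum of $c(G)$ over all graphs $G$ with $\alpha(G)=2$ is finite and equal to $C$. Then $C>\alpha(G^n)^{1/n}$ for every graph $G$ with $\alpha(G)=2$ and every integer $n\ge 1$. Hence the supremum is not attained by any finite graph power, i.e. there are no graph $G$ with $\alpha(G)=2$ and integer $n\ge1$ with $\alpha(G^n)^{1/n}=C$. -/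

import Mathlib

open Filter Topology

universe u v

namespace SimpleGraph

/-- The product `G₁ × ⋯ × Gₙ` of a family of graphs: distinct tuples are adjacent iff in every
coordinate their entries are equal or adjacent. -/
def prodFamily {ι : Type u} {V : ι → Type v} (G : ∀ i, SimpleGraph (V i)) :
    SimpleGraph (∀ i, V i) where
  Adj x y := x ≠ y ∧ ∀ i, x i = y i ∨ (G i).Adj (x i) (y i)
  symm := ⟨fun _ _ h => ⟨h.1.symm, fun i => (h.2 i).imp Eq.symm fun a => a.symm⟩⟩
  loopless := ⟨fun _ h => h.1 rfl⟩

/-- The `n`-fold power `Gⁿ = G × ⋯ × G`. -/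
def graphPow {V : Type u} (G : SimpleGraph V) (n : ℕ) : SimpleGraph (Fin n → V) :=
  prodFamily fun _ : Fin n => G

/-- The real number `α(Gⁿ)^(1/n)`. -/
noncomputable def powRate {V : Type u} (G : SimpleGraph V) (n : ℕ) : ℝ :=
  ((G.graphPow n).indepNum : ℝ) ^ (1 / (n : ℝ))

/-- `c` is the Shannon capacity of `G`: the limit of `α(Gⁿ)^(1/n)` as `n → ∞`. -/
def IsShannonCapacity {V : Type u} (G : SimpleGraph V) (c : ℝ) : Prop :=
  Tendsto (fun n : ℕ => G.powRate n) atTop (𝓝 c)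

/-- The set of Shannon capacities of all finite graphs with independence number `k`.
Every finite graph is isomorphic to one with vertex set in `Type`. -/
def shannonCapacities (k : ℕ) : Set ℝ :=
  {c | ∃ (V : Type) (_ : Finite V) (G : SimpleGraph V), G.indepNum = k ∧ G.IsShannonCapacity c}

end SimpleGraph

namespace SimpleGraph

/-! ### Independent sets as separated families -/

section Separated

variable {V : Type*} {W : Type*} {G : SimpleGraph V}

/-! Two distinct members of an independent set of `G ^ n` are separated in some coordinate; colour
the pair by it. If `α(G) = 2`, this `n`-colouring of a complete graph has no monochromatic triangle.
Conversely, `layerGraph` turns such a colouring of `N ≥ 2` points with `m` colours into a graph with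
`α = 2` whose `m`-th power has independence number at least `N`. Squaring a colouring doubles the
palette and squares `N`, and `squareExtendColoring` gains one more point: `N ^ 2 + 1` points with
`2n` colours. So every rate is strictly below the rate of another such graph at exponent `2n`, which
by Fekete's lemma is at most that graph's capacity, hence at most `C`. -/

lemma card_le_indepNum_of_separated [Finite V] [Finite W] (f : W → V)
    (hf : ∀ x y, x ≠ y → f x ≠ f y ∧ ¬ G.Adj (f x) (f y)) : Nat.card W ≤ G.indepNum := by
  classical
  have := Fintype.ofFinite W
  have hinj : Function.Injective f := fun x y h => by
    by_contra hne
    exact (hf x y hne).1 h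
  have hind : G.IsIndepSet (Finset.univ.image f : Finset V) := by
    rw [isIndepSet_iff]
    intro a ha b hb hab
    simp only [Finset.coe_image, Finset.coe_univ, Set.image_univ, Set.mem_range] at ha hb
    obtain ⟨x, rfl⟩ := ha
    obtain ⟨y, rfl⟩ := hb
    exact (hf x y fun h => hab (congrArg f h)).2
  have h := hind.card_le_indepNum
  rwa [Finset.card_image_of_injective _ hinj, Finset.card_univ, ← Nat.card_eq_fintype_card] at h

lemma exists_separated_fin_indepNum [Finite V] (G : SimpleGraph V) :
    ∃ f : Fin G.indepNum → V, ∀ x y, x ≠ y → f x ≠ f y ∧ ¬ G.Adj (f x) (f y) := by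
  obtain ⟨s, hs⟩ := G.exists_isNIndepSet_indepNum
  let e := (s.equivFinOfCardEq hs.card_eq).symm
  refine ⟨fun i => (e i : V), fun x y hxy => ?_⟩
  have hne : (e x : V) ≠ e y := fun h => hxy (e.injective (Subtype.ext h))
  exact ⟨hne, hs.isIndepSet (e x).2 (e y).2 hne⟩

lemma indepNum_le_two_iff [Finite V] : G.indepNum ≤ 2 ↔
    ∀ a b c, a ≠ b → a ≠ c → b ≠ c → G.Adj a b ∨ G.Adj a c ∨ G.Adj b c := by
  constructor
  · intro h a b c hab hac hbc
    by_contra! hadj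
    obtain ⟨h1, h2, h3⟩ := hadj
    have : Nat.card (Fin 3) ≤ G.indepNum := by
      refine card_le_indepNum_of_separated ![a, b, c] fun x y hxy => ?_
      fin_cases x <;> fin_cases y <;>
        simp_all [G.adj_comm, eq_comm]
    simp at this
    omega
  · intro h
    by_contra! hlt
    obtain ⟨f, hf⟩ := G.exists_separated_fin_indepNum
    have h01 := hf ⟨0, by omega⟩ ⟨1, by omega⟩ (by simp)
    have h02 := hf ⟨0, by omega⟩ ⟨2, by omega⟩ (by simp)
    have h12 := hf ⟨1, by omega⟩ ⟨2, by omega⟩ (by simp)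
    rcases h _ _ _ h01.1 h02.1 h12.1 with h | h | h
    exacts [h01.2 h, h02.2 h, h12.2 h]

/-- The separating coordinate later serves as the colour of the pair. -/
lemma ne_and_not_adj_graphPow {n : ℕ} {x y : Fin n → V} :
    x ≠ y ∧ ¬ (G.graphPow n).Adj x y ↔ ∃ i, x i ≠ y i ∧ ¬ G.Adj (x i) (y i) := by
  simp only [graphPow, prodFamily, not_and, not_forall, not_or]
  refine ⟨fun h => h.2 h.1, fun ⟨i, hi⟩ => ⟨fun h => hi.1 (congrFun h i), fun _ => ⟨i, hi⟩⟩⟩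

end Separated

/-! ### Existence of the Shannon capacity -/

section Capacity

variable {V : Type*} [Finite V] (G : SimpleGraph V)

lemma indepNum_graphPow_mul_le (m n : ℕ) :
    (G.graphPow m).indepNum * (G.graphPow n).indepNum ≤ (G.graphPow (m + n)).indepNum := by
  obtain ⟨f, hf⟩ := (G.graphPow m).exists_separated_fin_indepNum
  obtain ⟨g, hg⟩ := (G.graphPow n).exists_separated_fin_indepNum
  simp only [ne_and_not_adj_graphPow] at hf hg
  have h := card_le_indepNum_of_separated (G := G.graphPow (m + n))
    (fun p : Fin (G.graphPow m).indepNum × Fin (G.graphPow n).indepNum =>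
      Fin.append (f p.1) (g p.2)) (by
    rintro ⟨x, y⟩ ⟨x', y'⟩ hne
    rw [ne_and_not_adj_graphPow]
    by_cases hx : x = x'
    · obtain ⟨i, hi⟩ := hg y y' fun hy => hne (by rw [hx, hy])
      exact ⟨Fin.natAdd m i, by simpa using hi⟩
    · obtain ⟨i, hi⟩ := hf x x' hx
      exact ⟨Fin.castAdd n i, by simpa using hi⟩)
  simpa using h

lemma indepNum_le_card : G.indepNum ≤ Nat.card V := by
  obtain ⟨f, hf⟩ := G.exists_separated_fin_indepNum
  have := Nat.card_le_card_of_injective f fun x y h => by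
    by_contra hne
    exact (hf x y hne).1 h
  simpa using this

variable [Nonempty V]

lemma indepNum_pos : 0 < G.indepNum := by
  obtain ⟨v⟩ := ‹Nonempty V›
  have h := card_le_indepNum_of_separated (G := G) (fun _ : Unit => v)
    fun x y h => (h (Subsingleton.elim x y)).elim
  simpa [Nat.one_le_iff_ne_zero, Nat.pos_iff_ne_zero] using h

/-- The Shannon capacity exists, and it bounds every finite power rate from above. -/
theorem exists_isShannonCapacity :
    ∃ c, G.IsShannonCapacity c ∧ ∀ n : ℕ, n ≠ 0 → G.powRate n ≤ c := by
  -- The sign turns supermultiplicativity into the subadditivity that Fekete's lemma needs.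
  let u : ℕ → ℝ := fun n => -Real.log (G.graphPow n).indepNum
  have hpos : ∀ n, (0 : ℝ) < (G.graphPow n).indepNum := fun n =>
    Nat.cast_pos.2 (G.graphPow n).indepNum_pos
  have hsub : Subadditive u := fun m n => by
    have h : ((G.graphPow m).indepNum * (G.graphPow n).indepNum : ℝ) ≤
        (G.graphPow (m + n)).indepNum := mod_cast G.indepNum_graphPow_mul_le m n
    have := Real.log_le_log (mul_pos (hpos m) (hpos n)) h
    rw [Real.log_mul (hpos m).ne' (hpos n).ne'] at this
    simp only [u]
    linarith
  have hcard : (1 : ℝ) ≤ Nat.card V := Nat.one_le_cast.2 Nat.card_pos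
  have hbdd : BddBelow (Set.range fun n => u n / n) := by
    refine ⟨-Real.log (Nat.card V), ?_⟩
    rintro _ ⟨n, rfl⟩
    have h1 : ((G.graphPow n).indepNum : ℝ) ≤ (Nat.card V : ℝ) ^ n := by
      have := (G.graphPow n).indepNum_le_card
      rw [Nat.card_fun, Nat.card_fin] at this
      exact_mod_cast this
    have h2 := Real.log_le_log (hpos n) h1
    rw [Real.log_pow] at h2
    -- At `n = 0` the quotient is `0` by convention, so the bound needs `log |V| ≥ 0`.
    rcases n.eq_zero_or_pos with rfl | hn
    · simpa using Real.log_nonneg hcard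
    · have hn' : (0 : ℝ) < n := Nat.cast_pos.2 hn
      simp only [u]
      rw [le_div_iff₀ hn']
      linarith
  have hrate : ∀ n : ℕ, G.powRate n = Real.exp (-(u n / n)) := fun n => by
    rw [powRate, Real.rpow_def_of_pos (hpos n)]
    congr 1
    simp only [u]
    ring
  refine ⟨Real.exp (-hsub.lim), ?_, fun n hn => ?_⟩
  · simp only [IsShannonCapacity, hrate]
    exact (Real.continuous_exp.tendsto _).comp (hsub.tendsto_lim hbdd).neg
  · rw [hrate]
    exact Real.exp_le_exp.2 (neg_le_neg (hsub.lim_le_div hbdd hn))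

end Capacity

/-! ### Triangle-free colourings and graphs with independence number two -/

section Coloring

/-- A symmetric function `c` on pairs, viewed as a colouring of the edges of the complete graph
on `W`, has no monochromatic triangle. -/
def IsTriangleFreeColoring {W ι : Type*} (c : W → W → ι) : Prop :=
  (∀ x y, c x y = c y x) ∧
    ∀ x y z, x ≠ y → x ≠ z → y ≠ z → c x y = c x z → c x y ≠ c y z

lemma exists_isTriangleFreeColoring {V : Type*} [Finite V] {G : SimpleGraph V}
    (hG : G.indepNum ≤ 2) {n : ℕ} (hn : 1 ≤ n) :
    ∃ c : Fin (G.graphPow n).indepNum → Fin (G.graphPow n).indepNum → Fin n,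
      IsTriangleFreeColoring c := by
  obtain ⟨f, hf⟩ := (G.graphPow n).exists_separated_fin_indepNum
  simp only [ne_and_not_adj_graphPow] at hf
  have : Nonempty (Fin n) := ⟨⟨0, hn⟩⟩
  -- The predicate is symmetric in `x` and `y`, so `epsilon` picks the same coordinate for both
  -- orders; on the diagonal its value is irrelevant.
  let c : Fin (G.graphPow n).indepNum → Fin (G.graphPow n).indepNum → Fin n := fun x y =>
    Classical.epsilon fun i => f x i ≠ f y i ∧ ¬ G.Adj (f x i) (f y i)
  have hc : ∀ x y, x ≠ y → f x (c x y) ≠ f y (c x y) ∧ ¬ G.Adj (f x (c x y)) (f y (c x y)) :=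
    fun x y hxy => Classical.epsilon_spec (hf x y hxy)
  refine ⟨c, fun x y => ?_, fun x y z hxy hxz hyz h1 h2 => ?_⟩
  · simp only [c, ne_comm, G.adj_comm]
  · have a := hc x y hxy
    have b := hc x z hxz
    have d := hc y z hyz
    rw [← h1] at b
    rw [← h2] at d
    rcases indepNum_le_two_iff.1 hG _ _ _ a.1 b.1 d.1 with h | h | h
    exacts [a.2 h, b.2 h, d.2 h]

open Classical in
/-- The product colouring of `W × W` with two disjoint palettes, extended to one more vertex.
The new vertex sees `(x, y)` as `(y, y)` does, except that it sees the diagonal in a single colour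
of the second palette; pairs in general position avoid the palette in which the new vertex sees
both of them. -/
noncomputable def squareExtendColoring {W ι : Type*} (c : W → W → ι) (i₀ : ι) :
    Option (W × W) → Option (W × W) → ι ⊕ ι
  | none, none => .inr i₀
  | none, some (x, y) => if x = y then .inr i₀ else .inl (c x y)
  | some (x, y), none => if x = y then .inr i₀ else .inl (c x y)
  | some (x, y), some (x', y') =>
      if x = x' ∨ (y ≠ y' ∧ x ≠ y ∧ x' ≠ y') then .inr (c y y') else .inl (c x x')

/-- Between distinct pairs, `inl` colours occur only when first entries differ and `inr` colours
only when second entries differ, so a monochromatic triangle of pairs would project to one of `c`.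
-/
lemma IsTriangleFreeColoring.squareExtend {W ι : Type*} {c : W → W → ι}
    (hc : IsTriangleFreeColoring c) (i₀ : ι) :
    IsTriangleFreeColoring (squareExtendColoring c i₀) := by
  obtain ⟨hsymm, htri⟩ := hc
  have hsymm' : ∀ p q, squareExtendColoring c i₀ p q = squareExtendColoring c i₀ q p := by
    rintro (_ | ⟨x, y⟩) (_ | ⟨x', y'⟩) <;> simp only [squareExtendColoring]
    have := hsymm x x'
    have := hsymm y y'
    grind
  -- Triangles through the new vertex. Two diagonal pairs are joined in the first palette but seen
  -- in the second. Two off-diagonal pairs are joined in the first palette only if `y = y'` and `x ≠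
  -- x'`; then `x`, `x'`, `y` would be a monochromatic triangle of `c`.
  have hnone : ∀ p q : W × W, p ≠ q →
      squareExtendColoring c i₀ none (some p) = squareExtendColoring c i₀ none (some q) →
      squareExtendColoring c i₀ none (some p) ≠ squareExtendColoring c i₀ (some p) (some q) := by
    rintro ⟨x, y⟩ ⟨x', y'⟩ hne h1 h2
    simp only [squareExtendColoring] at h1 h2
    have := htri x x' y
    grind
  refine ⟨hsymm', ?_⟩
  rintro (_ | p) (_ | q) (_ | r) hpq hpr hqr h1 h2
  any_goals exact absurd rfl ‹_›
  · exact hnone q r (by simpa using hqr) h1 h2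
  · exact hnone p r (by simpa using hpr) (by rw [hsymm' none, h2])
      (by rw [hsymm' none, h1])
  · exact hnone p q (by simpa using hpq) (by rw [hsymm' none, hsymm' none, ← h1, h2])
      (by rw [hsymm' none, h1])
  · obtain ⟨x, y⟩ := p
    obtain ⟨x', y'⟩ := q
    obtain ⟨x'', y''⟩ := r
    simp only [squareExtendColoring] at h1 h2
    simp only [ne_eq, Option.some.injEq, Prod.mk.injEq] at hpq hpr hqr
    have hx := htri x x' x''
    have hy := htri y y' y''
    grind

/-- The graph whose layer `i` is the complement of the colour class `i`, with all edges between
different layers. -/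
def layerGraph {W ι : Type*} (c : W → W → ι) (hc : ∀ x y, c x y = c y x) :
    SimpleGraph (W × ι) where
  Adj p q := p ≠ q ∧ (p.2 = q.2 → c p.1 q.1 ≠ p.2)
  symm := ⟨fun p q h => ⟨h.1.symm, fun e => by rw [hc, e]; exact h.2 e.symm⟩⟩
  loopless := ⟨fun _ h => h.1 rfl⟩

/-- Three independent vertices would share a layer `i` and form a triangle of colour `i`. Any two
points, placed in the layer of their colour, are independent. -/
lemma layerGraph_indepNum {W ι : Type*} [Finite W] [Nontrivial W] [Finite ι] {c : W → W → ι}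
    (hc : IsTriangleFreeColoring c) : (layerGraph c hc.1).indepNum = 2 := by
  apply le_antisymm
  · rw [indepNum_le_two_iff]
    rintro ⟨x, i⟩ ⟨y, j⟩ ⟨z, k⟩ h1 h2 h3
    have := hc.2 x y z
    simp only [ne_eq, Prod.mk.injEq] at h1 h2 h3
    simp only [layerGraph, ne_eq, Prod.mk.injEq]
    grind
  · obtain ⟨x, y, hxy⟩ := exists_pair_ne W
    have h := card_le_indepNum_of_separated (G := layerGraph c hc.1) (W := Bool)
      (fun b => (if b then x else y, c x y)) (by
        have := hc.1 x y
        rintro (_ | _) (_ | _) h <;> simp_all [layerGraph, hxy.symm])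
    simpa using h

/-- The tuples running through all copies of one point are independent: those of `x` and `y` are
separated in coordinate `c x y`. -/
lemma card_le_layerGraph_graphPow_indepNum {W : Type*} {m : ℕ} [Finite W] {c : W → W → Fin m}
    (hc : ∀ x y, c x y = c y x) :
    Nat.card W ≤ ((layerGraph c hc).graphPow m).indepNum := by
  refine card_le_indepNum_of_separated (fun w i => (w, i)) fun x y hxy => ?_
  rw [ne_and_not_adj_graphPow]
  exact ⟨c x y, by simp [layerGraph, hxy]⟩

end Coloring

/-- Every power of a graph with independence number `2` is beaten, at twice the exponent, by a power
of another such graph. -/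
theorem exists_sq_lt_indepNum_graphPow {V : Type*} [Finite V] {G : SimpleGraph V}
    (hG : G.indepNum = 2) {n : ℕ} (hn : 1 ≤ n) :
    ∃ (V' : Type) (_ : Finite V') (_ : Nonempty V') (G' : SimpleGraph V'), G'.indepNum = 2 ∧
      (G.graphPow n).indepNum ^ 2 < (G'.graphPow (n + n)).indepNum := by
  obtain ⟨c, hc⟩ := exists_isTriangleFreeColoring hG.le hn
  have : Nonempty V := by
    have h := G.indepNum_le_card
    rw [hG] at h
    exact (Nat.card_pos_iff.1 (by omega)).1
  have : Nonempty (Fin (G.graphPow n).indepNum) := ⟨⟨0, (G.graphPow n).indepNum_pos⟩⟩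
  have hd := hc.squareExtend ⟨0, hn⟩
  have hd' : IsTriangleFreeColoring fun p q =>
      finSumFinEquiv (squareExtendColoring c ⟨0, hn⟩ p q) :=
    ⟨fun p q => congrArg finSumFinEquiv (hd.1 p q), fun p q r h1 h2 h3 h4 h5 =>
      hd.2 p q r h1 h2 h3 (finSumFinEquiv.injective h4) (finSumFinEquiv.injective h5)⟩
  refine ⟨_, inferInstance, ⟨none, ⟨0, by omega⟩⟩, layerGraph _ hd'.1, layerGraph_indepNum hd', ?_⟩
  refine lt_of_lt_of_le ?_ (card_le_layerGraph_graphPow_indepNum hd'.1)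
  -- `Option (W × W)` has `N * N + 1` elements; the added vertex makes the inequality strict.
  simp [sq]

end SimpleGraph

theorem theorem3 (C : ℝ) (hC : IsLUB (SimpleGraph.shannonCapacities 2) C) :
    (∀ (V : Type u) [Finite V] (G : SimpleGraph V) (n : ℕ), G.indepNum = 2 → 1 ≤ n →
      ((G.graphPow n).indepNum : ℝ) ^ (1 / (n : ℝ)) < C) ∧
    ¬ ∃ (V : Type u) (_ : Finite V) (G : SimpleGraph V) (n : ℕ), G.indepNum = 2 ∧ 1 ≤ n ∧
      ((G.graphPow n).indepNum : ℝ) ^ (1 / (n : ℝ)) = C := by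
  have main : ∀ (V : Type u) [Finite V] (G : SimpleGraph V) (n : ℕ), G.indepNum = 2 → 1 ≤ n →
      ((G.graphPow n).indepNum : ℝ) ^ (1 / (n : ℝ)) < C := by
    intro V _ G n hG hn
    obtain ⟨V', _, _, G', hG', hlt⟩ := SimpleGraph.exists_sq_lt_indepNum_graphPow hG hn
    obtain ⟨c, hc, hle⟩ := G'.exists_isShannonCapacity
    have hn' : (0 : ℝ) < n := Nat.cast_pos.2 hn
    calc ((G.graphPow n).indepNum : ℝ) ^ (1 / (n : ℝ))
        = (((G.graphPow n).indepNum : ℝ) ^ 2) ^ (1 / ((n + n : ℕ) : ℝ)) := by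
          rw [← Real.rpow_natCast, ← Real.rpow_mul (Nat.cast_nonneg _)]
          congr 1
          push_cast
          field_simp
          norm_num
      _ < G'.powRate (n + n) :=
          Real.rpow_lt_rpow (by positivity) (mod_cast hlt) (by positivity)
      _ ≤ c := hle _ (by omega)
      _ ≤ C := hC.1 ⟨V', inferInstance, G', hG', hc⟩
  refine ⟨main, ?_⟩
  rintro ⟨V, _, G, n, hG, hn, h⟩
  exact (main V G n hG hn).ne h
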